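/- Let $p\ge 1$ be an integer, let $\rho>0$, and let $\widehat\Sigma, X\in\mathbb R^{p\times p}$ be symmetric positive definite matrices. For probability distributions $P_1,P_2$ on $\mathbb R^p$ with finite second moments let $$W_2(P_1,P_2)=\inf_{\pi}\Big(\int_{\mathbb R^p\times\mathbb R^p}\|\xi_1-\xi_2\|^2\,\pi(d\xi_1,d\xi_2)\Big)^{1/2},$$ where $\|\cdot\|$ is the Euclidean norm and $\pi$ ranges over all joint distributions with marginals $P_1$ and $P_2$. Let $\mathcal N^p_0$ be the set of all (possibly degenerate) normal distributions $\mathcal N(0,S)$ on $\mathbb R^p$ with $S$ symmetric positive semidefinite, put $\widehat P=\mathcal N(0,\widehat\Sigma)$ and $\mathcal P=\{Q\in\mathcal N^p_0: W_2(Q,\widehat P)\le\rho\}$, and consider the worst-case expectation $$g=\sup_{Q\in\mathcal P}\mathbb E^{Q}\big[\langle \xi\xi^\top,X\rangle\big],\qquad \langle A,B\rangle=\operatorname{Tr}(A^\top B),$$ where $\xi$ has distribution $Q$ under $\mathbb E^Q$. For symmetric matrices, $A\succ B$ means that $A-B$ is positive definite. Then there is exactly one real number $\gamma^\star$ with $\gamma^\star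 I\succ X$ that satisfies $$\rho^2-\operatorname{Tr}(\widehat\Sigma)+2\gamma^\star\operatorname{Tr}\big((\gamma^\star I-X)^{-1}\widehat\Sigma\big)-(\gamma^\star)^2\operatorname{Tr}\big((\gamma^\star I-X)^{-1}\widehat\Sigma(\gamma^\star I-X)^{-1}\big)=0 .$$ The random variable $\langle\xi\xi^\top,X\rangle$ is integrable under every $Q\in\mathcal P$. With the positive semidefinite matrix $$S^\star=(\gamma^\star)^2(\gamma^\star I-X)^{-1}\widehat\Sigma(\gamma^\star I-X)^{-1},$$ the normal distribution $Q^\star=\mathcal N(0,S^\star)$ belongs to $\mathcal P$ and attains the supremum, that is, $\mathbb E^{Q^\star}[\langle\xi\xi^\top,X\rangle]=g$. Moreover $W_2(Q^\star,\widehat P)=\rho$. -/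

import Mathlib

open MeasureTheory ProbabilityTheory
open scoped ENNReal Matrix

/-- `π` is a joint distribution with marginals `P₁` and `P₂`. -/
def IsCouplingOf {p : ℕ} (P₁ P₂ : Measure (EuclideanSpace ℝ (Fin p)))
    (π : Measure (EuclideanSpace ℝ (Fin p) × EuclideanSpace ℝ (Fin p))) : Prop :=
  π.map Prod.fst = P₁ ∧ π.map Prod.snd = P₂

/-- The type-2 Wasserstein distance on `ℝᵖ` with the Euclidean norm, with values in `[0, ∞]`
(it is finite on distributions with finite second moments). -/
noncomputable def wasserstein2 {p : ℕ} (P₁ P₂ : Measure (EuclideanSpace ℝ (Fin p))) : ℝ≥0∞ :=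
  ⨅ (π : Measure (EuclideanSpace ℝ (Fin p) × EuclideanSpace ℝ (Fin p)))
    (_ : IsCouplingOf P₁ P₂ π), (∫⁻ z, ‖z.1 - z.2‖ₑ ^ 2 ∂π) ^ (1 / 2 : ℝ)

/-- The inner product `⟨A, B⟩ = Tr(Aᵀ B)` of square matrices. -/
def matrixInner {p : ℕ} (A B : Matrix (Fin p) (Fin p) ℝ) : ℝ :=
  (Aᵀ * B).trace

/-- The family of all (possibly degenerate) normal distributions `N(0, S)` on `ℝᵖ`. -/
def centeredNormals (p : ℕ) : Set (Measure (EuclideanSpace ℝ (Fin p))) :=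
  {Q | ∃ S : Matrix (Fin p) (Fin p) ℝ, S.PosSemidef ∧ Q = multivariateGaussian 0 S}

/-- The zero-mean normal distributions at type-2 Wasserstein distance at most `ρ` from the
nominal distribution `N(0, S₀)`. -/
def ambiguitySet {p : ℕ} (ρ : ℝ) (S₀ : Matrix (Fin p) (Fin p) ℝ) :
    Set (Measure (EuclideanSpace ℝ (Fin p))) :=
  {Q | Q ∈ centeredNormals p ∧
    wasserstein2 Q (multivariateGaussian 0 S₀) ≤ ENNReal.ofReal ρ}

/-- The integrand `⟨ξ ξᵀ, X⟩`. -/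
def quadLoss {p : ℕ} (X : Matrix (Fin p) (Fin p) ℝ) (ξ : EuclideanSpace ℝ (Fin p)) : ℝ :=
  matrixInner (Matrix.vecMulVec ξ ξ) X

/-- The worst-case expectation `sup {E^Q[⟨ξ ξᵀ, X⟩] : Q in the ambiguity set}`, taken in the
extended reals, so that it is a genuine supremum. -/
noncomputable def worstCaseExpectation {p : ℕ} (ρ : ℝ) (S₀ X : Matrix (Fin p) (Fin p) ℝ) :
    EReal :=
  ⨆ Q ∈ ambiguitySet ρ S₀, ((∫ ξ, quadLoss X ξ ∂Q : ℝ) : EReal)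

/-- `γ` satisfies `γ I ≻ X` and the first-order equation
`ρ² - Tr S₀ + 2 γ Tr((γ I - X)⁻¹ S₀) - γ² Tr((γ I - X)⁻¹ S₀ (γ I - X)⁻¹) = 0`. -/
def IsDualSolution {p : ℕ} (ρ : ℝ) (S₀ X : Matrix (Fin p) (Fin p) ℝ) (γ : ℝ) : Prop :=
  (γ • (1 : Matrix (Fin p) (Fin p) ℝ) - X).PosDef ∧
    ρ ^ 2 - S₀.trace + 2 * γ * ((γ • 1 - X)⁻¹ * S₀).trace
      - γ ^ 2 * ((γ • 1 - X)⁻¹ * S₀ * (γ • 1 - X)⁻¹).trace = 0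

/-- The matrix `γ² (γ I - X)⁻¹ S₀ (γ I - X)⁻¹`. -/
noncomputable def extremalCov {p : ℕ} (S₀ X : Matrix (Fin p) (Fin p) ℝ) (γ : ℝ) :
    Matrix (Fin p) (Fin p) ℝ :=
  γ ^ 2 • ((γ • 1 - X)⁻¹ * S₀ * (γ • 1 - X)⁻¹)

/-! The proof is Lagrangian duality with multiplier `γ`, without a formula for the distance between
Gaussians. Put N = (γI - X)⁻¹. Completing a square gives xᵀXx ≤ γ‖x - y‖² + γ² yᵀNy - γ‖y‖², with
equality iff x = γNy. Integrated over couplings, this bounds `wasserstein2` from below by the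
expected loss (`ofReal_sqrt_le_wasserstein2`). The map y ↦ γNy sends N(0, S₀) to the extremal law
(`wasserstein2_multivariateGaussian_le`), and the first-order equation says exactly that its
transport cost is ρ². Hence the bound is tight, which gives both optimality and distance ρ. For
existence and uniqueness of `γ`, note γN - I = XN. In an eigenbasis of X the cost is ∑ rᵢ (dᵢ/(γ -
dᵢ))², which decreases strictly from ∞ to 0 as `γ` runs from max dᵢ to ∞. -/

/-! ### Second moments and linear images of centered Gaussians. -/

lemma quadLoss_eq_dotProduct {p : ℕ} (A : Matrix (Fin p) (Fin p) ℝ) (ξ : EuclideanSpace ℝ (Fin p)) :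
    quadLoss A ξ = ξ.ofLp ⬝ᵥ A *ᵥ ξ.ofLp := by
  rw [quadLoss, matrixInner, Matrix.transpose_vecMulVec, Matrix.vecMulVec_mul,
    Matrix.trace_vecMulVec, dotProduct_comm, ← Matrix.dotProduct_mulVec]

lemma quadLoss_eq_sum {p : ℕ} (A : Matrix (Fin p) (Fin p) ℝ) (ξ : EuclideanSpace ℝ (Fin p)) :
    quadLoss A ξ = ∑ i, ∑ j, A i j * (ξ i * ξ j) := by
  rw [quadLoss_eq_dotProduct]
  simp only [dotProduct, Matrix.mulVec, Finset.mul_sum]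
  exact Finset.sum_congr rfl fun i _ ↦ Finset.sum_congr rfl fun j _ ↦ by ring

lemma memLp_two_eval_of_isGaussian {p : ℕ} (Q : Measure (EuclideanSpace ℝ (Fin p))) [IsGaussian Q]
    (i : Fin p) : MemLp (fun x : EuclideanSpace ℝ (Fin p) ↦ x i) 2 Q :=
  IsGaussian.memLp_dual Q (EuclideanSpace.proj i) 2 (by norm_num)

lemma integrable_eval_mul_eval {p : ℕ} (Q : Measure (EuclideanSpace ℝ (Fin p))) [IsGaussian Q]
    (i j : Fin p) : Integrable (fun x : EuclideanSpace ℝ (Fin p) ↦ x i * x j) Q :=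
  (memLp_two_eval_of_isGaussian Q i).integrable_mul (memLp_two_eval_of_isGaussian Q j)

lemma integrable_quadLoss {p : ℕ} (A : Matrix (Fin p) (Fin p) ℝ)
    (Q : Measure (EuclideanSpace ℝ (Fin p))) [IsGaussian Q] : Integrable (quadLoss A) Q := by
  rw [funext (quadLoss_eq_sum A)]
  exact integrable_finsetSum _ fun i _ ↦ integrable_finsetSum _ fun j _ ↦
    (integrable_eval_mul_eval Q i j).const_mul _

lemma integral_eval_mul_eval_multivariateGaussian {p : ℕ} {S : Matrix (Fin p) (Fin p) ℝ}
    (hS : S.PosSemidef) (i j : Fin p) :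
    ∫ x : EuclideanSpace ℝ (Fin p), x i * x j ∂(multivariateGaussian 0 S) = S i j := by
  have mean (k : Fin p) : ∫ x : EuclideanSpace ℝ (Fin p), x k ∂(multivariateGaussian 0 S) = 0 := by
    have := IsGaussian.integral_dual (μ := multivariateGaussian 0 S)
      (EuclideanSpace.proj k : EuclideanSpace ℝ (Fin p) →L[ℝ] ℝ)
    simpa using this
  rw [← covariance_eval_multivariateGaussian (μ := 0) hS i j,
    covariance_eq_sub (memLp_two_eval_of_isGaussian _ i) (memLp_two_eval_of_isGaussian _ j),
    mean i, zero_mul, sub_zero]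
  rfl

lemma integral_quadLoss_multivariateGaussian {p : ℕ} (A : Matrix (Fin p) (Fin p) ℝ)
    {S : Matrix (Fin p) (Fin p) ℝ} (hS : S.PosSemidef) :
    ∫ ξ, quadLoss A ξ ∂(multivariateGaussian 0 S) = (A * S).trace := by
  have key (a : Fin p → Fin p → ℝ) : ∫ ξ : EuclideanSpace ℝ (Fin p),
      ∑ i, ∑ j, a i j * (ξ i * ξ j) ∂(multivariateGaussian 0 S) = ∑ i, ∑ j, a i j * S i j := by
    rw [integral_finsetSum _ fun i _ ↦ integrable_finsetSum _ fun j _ ↦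
      (integrable_eval_mul_eval _ i j).const_mul _]
    refine Finset.sum_congr rfl fun i _ ↦ ?_
    rw [integral_finsetSum _ fun j _ ↦ (integrable_eval_mul_eval _ i j).const_mul _]
    refine Finset.sum_congr rfl fun j _ ↦ ?_
    rw [integral_const_mul, integral_eval_mul_eval_multivariateGaussian hS]
  simp_rw [quadLoss_eq_sum]
  refine (key A).trans ?_
  simp only [Matrix.trace, Matrix.diag, Matrix.mul_apply]
  refine Finset.sum_congr rfl fun i _ ↦ Finset.sum_congr rfl fun j _ ↦ ?_
  rw [← hS.isHermitian.apply i j, star_trivial]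

/-- A Gaussian law is determined by its mean and covariance form; this also covers singular
covariances. -/
lemma multivariateGaussian_map_toEuclideanCLM {p : ℕ} (A : Matrix (Fin p) (Fin p) ℝ)
    {S : Matrix (Fin p) (Fin p) ℝ} (hS : S.PosSemidef) :
    (multivariateGaussian 0 S).map (Matrix.toEuclideanCLM (𝕜 := ℝ) A)
      = multivariateGaussian 0 (A * S * Aᵀ) := by
  have hS' : (A * S * Aᵀ).PosSemidef := by simpa using hS.mul_mul_conjTranspose_same A
  refine IsGaussian.ext ?_ (ContinuousLinearMap.ext fun x ↦ ContinuousLinearMap.ext fun y ↦ ?_)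
  · rw [integral_id_multivariateGaussian']
    simp only [id_eq]
    rw [ContinuousLinearMap.integral_id_map IsGaussian.integrable_id]
    simp
  · rw [covarianceBilin_map IsGaussian.memLp_two_id, covarianceBilin_multivariateGaussian hS,
      covarianceBilin_multivariateGaussian hS', ← ContinuousLinearMap.star_eq_adjoint, ← map_star]
    simp only [Matrix.ofLp_toEuclideanCLM, Matrix.star_eq_conjTranspose,
      Matrix.conjTranspose_eq_transpose_of_trivial, ← Matrix.mulVec_mulVec]
    rw [Matrix.mulVec_transpose, ← Matrix.dotProduct_mulVec]

/-! ### Weak duality and the lower bound on the Wasserstein distance. -/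

/-- Weak duality, pointwise. -/
lemma quadLoss_le_of_posDef {p : ℕ} {X : Matrix (Fin p) (Fin p) ℝ} {γ : ℝ}
    (h : (γ • (1 : Matrix (Fin p) (Fin p) ℝ) - X).PosDef) (x y : EuclideanSpace ℝ (Fin p)) :
    quadLoss X x ≤ γ * ‖x - y‖ ^ 2 + (γ ^ 2 * quadLoss ((γ • 1 - X)⁻¹) y - γ * ‖y‖ ^ 2) := by
  set M := γ • (1 : Matrix (Fin p) (Fin p) ℝ) - X with hM
  have hMt : Mᵀ = M := by simpa using h.isHermitian.eq
  have hMN : M * M⁻¹ = 1 := Matrix.mul_nonsing_inv _ h.det_pos.ne'.isUnit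
  have hX : X = γ • 1 - M := by simp [hM]
  -- The gap between the two sides is the form of M at x - γM⁻¹y.
  have key := h.posSemidef.dotProduct_mulVec_nonneg (x.ofLp - γ • M⁻¹ *ᵥ y.ofLp)
  have hsymm (u v : Fin p → ℝ) : u ⬝ᵥ M *ᵥ v = v ⬝ᵥ M *ᵥ u := by
    rw [Matrix.dotProduct_mulVec, ← Matrix.mulVec_transpose, hMt, dotProduct_comm]
  simp only [quadLoss_eq_dotProduct, EuclideanSpace.real_norm_sq_eq]
  have e (v : Fin p → ℝ) : ∑ i, v i ^ 2 = v ⬝ᵥ v := by simp [dotProduct, sq]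
  rw [e, e, hX]
  simp only [star_trivial, Matrix.mulVec_sub, sub_dotProduct, dotProduct_sub, Matrix.mulVec_smul,
    smul_dotProduct, dotProduct_smul, Matrix.mulVec_mulVec, hMN, Matrix.one_mulVec, smul_eq_mul,
    Matrix.sub_mulVec, Matrix.smul_mulVec, WithLp.ofLp_sub] at key ⊢
  rw [hsymm (M⁻¹ *ᵥ y.ofLp), Matrix.mulVec_mulVec, hMN, Matrix.one_mulVec,
    dotProduct_comm (M⁻¹ *ᵥ y.ofLp)] at key
  rw [dotProduct_comm y.ofLp x.ofLp]
  nlinarith [key]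

lemma lintegral_enorm_sq_eq_ofReal {Ω E : Type*} [MeasurableSpace Ω] [NormedAddCommGroup E]
    {μ : Measure Ω} {f : Ω → E} (hf : MemLp f 2 μ) :
    ∫⁻ ω, ‖f ω‖ₑ ^ 2 ∂μ = ENNReal.ofReal (∫ ω, ‖f ω‖ ^ 2 ∂μ) := by
  rw [ofReal_integral_eq_lintegral_ofReal (hf.integrable_norm_pow two_ne_zero)
    (.of_forall fun ω ↦ by positivity)]
  refine lintegral_congr fun ω ↦ ?_
  rw [ENNReal.ofReal_pow (norm_nonneg _), ofReal_norm]

lemma integral_norm_sq_multivariateGaussian {p : ℕ} {S : Matrix (Fin p) (Fin p) ℝ}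
    (hS : S.PosSemidef) : ∫ ξ, ‖ξ‖ ^ 2 ∂(multivariateGaussian 0 S) = S.trace := by
  rw [← one_mul S, ← integral_quadLoss_multivariateGaussian 1 (by simpa using hS), one_mul]
  refine integral_congr_ae (.of_forall fun ξ ↦ ?_)
  simp only [quadLoss_eq_dotProduct, EuclideanSpace.real_norm_sq_eq, Matrix.one_mulVec, dotProduct]
  exact Finset.sum_congr rfl fun i _ ↦ sq _

lemma integrable_norm_sq_of_isGaussian {p : ℕ} (Q : Measure (EuclideanSpace ℝ (Fin p)))
    [IsGaussian Q] : Integrable (fun ξ ↦ ‖ξ‖ ^ 2) Q :=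
  (IsGaussian.memLp_two_id (μ := Q)).integrable_norm_pow two_ne_zero

/-- Weak duality for a single coupling. -/
lemma integral_quadLoss_le_of_isCouplingOf {p : ℕ} {S₀ X : Matrix (Fin p) (Fin p) ℝ} {γ : ℝ}
    (hS₀ : S₀.PosSemidef) (h : (γ • (1 : Matrix (Fin p) (Fin p) ℝ) - X).PosDef)
    {Q : Measure (EuclideanSpace ℝ (Fin p))} [IsGaussian Q]
    {π : Measure (EuclideanSpace ℝ (Fin p) × EuclideanSpace ℝ (Fin p))}
    (hπ : IsCouplingOf Q (multivariateGaussian 0 S₀) π) :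
    ∫ ξ, quadLoss X ξ ∂Q ≤ γ * ∫ z, ‖z.1 - z.2‖ ^ 2 ∂π +
      (γ ^ 2 * ((γ • 1 - X)⁻¹ * S₀).trace - γ * S₀.trace) := by
  have h₁ : MeasurePreserving Prod.fst π Q := ⟨measurable_fst, hπ.1⟩
  have h₂ : MeasurePreserving Prod.snd π (multivariateGaussian 0 S₀) := ⟨measurable_snd, hπ.2⟩
  have hd : Integrable (fun z ↦ ‖z.1 - z.2‖ ^ 2) π :=
    (((IsGaussian.memLp_two_id (μ := Q)).comp_measurePreserving h₁).sub
      (IsGaussian.memLp_two_id.comp_measurePreserving h₂)).integrable_norm_pow two_ne_zero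
  have hq : Integrable (fun y ↦ γ ^ 2 * quadLoss ((γ • 1 - X)⁻¹) y - γ * ‖y‖ ^ 2)
      (multivariateGaussian 0 S₀) :=
    ((integrable_quadLoss _ _).const_mul _).sub ((integrable_norm_sq_of_isGaussian _).const_mul _)
  have hq' : Integrable (fun z ↦ γ ^ 2 * quadLoss ((γ • 1 - X)⁻¹) z.2 - γ * ‖z.2‖ ^ 2) π :=
    h₂.integrable_comp_of_integrable hq
  have e₁ : ∫ z, quadLoss X z.1 ∂π = ∫ ξ, quadLoss X ξ ∂Q := by
    rw [← hπ.1, integral_map measurable_fst.aemeasurable]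
    rw [hπ.1]
    exact (integrable_quadLoss X Q).aestronglyMeasurable
  have e₂ : ∫ z, (γ ^ 2 * quadLoss ((γ • 1 - X)⁻¹) z.2 - γ * ‖z.2‖ ^ 2) ∂π
      = γ ^ 2 * ((γ • 1 - X)⁻¹ * S₀).trace - γ * S₀.trace := by
    rw [← integral_quadLoss_multivariateGaussian _ hS₀,
      ← integral_norm_sq_multivariateGaussian hS₀, ← integral_const_mul, ← integral_const_mul,
      ← integral_sub ((integrable_quadLoss _ _).const_mul _)
        ((integrable_norm_sq_of_isGaussian _).const_mul _)]
    conv_rhs => rw [← hπ.2]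
    rw [integral_map measurable_snd.aemeasurable]
    rw [hπ.2]
    exact hq.aestronglyMeasurable
  rw [← e₁, ← e₂, ← integral_const_mul, ← integral_add (hd.const_mul _) hq']
  exact integral_mono (h₁.integrable_comp_of_integrable (integrable_quadLoss X Q))
    ((hd.const_mul _).add hq') fun z ↦ quadLoss_le_of_posDef h z.1 z.2

/-- Weak duality: a lower bound of the Wasserstein distance by the expected loss. -/
lemma ofReal_sqrt_le_wasserstein2 {p : ℕ} {S₀ X : Matrix (Fin p) (Fin p) ℝ} {γ : ℝ}
    (hγ : 0 < γ) (hS₀ : S₀.PosSemidef) (h : (γ • (1 : Matrix (Fin p) (Fin p) ℝ) - X).PosDef)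
    (Q : Measure (EuclideanSpace ℝ (Fin p))) [IsGaussian Q] :
    ENNReal.ofReal √((∫ ξ, quadLoss X ξ ∂Q -
      (γ ^ 2 * ((γ • 1 - X)⁻¹ * S₀).trace - γ * S₀.trace)) / γ) ≤
      wasserstein2 Q (multivariateGaussian 0 S₀) := by
  refine le_iInf₂ fun π hπ ↦ ?_
  have h₁ : MeasurePreserving Prod.fst π Q := ⟨measurable_fst, hπ.1⟩
  have h₂ : MeasurePreserving Prod.snd π (multivariateGaussian 0 S₀) := ⟨measurable_snd, hπ.2⟩
  have hd : MemLp (fun z ↦ z.1 - z.2) 2 π :=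
    ((IsGaussian.memLp_two_id (μ := Q)).comp_measurePreserving h₁).sub
      (IsGaussian.memLp_two_id.comp_measurePreserving h₂)
  rw [lintegral_enorm_sq_eq_ofReal hd,
    ENNReal.ofReal_rpow_of_nonneg (integral_nonneg fun z ↦ by positivity) (by norm_num),
    ← Real.sqrt_eq_rpow]
  -- No sign condition is needed: the real root of a negative number is 0.
  gcongr
  rw [div_le_iff₀ hγ]
  linarith [integral_quadLoss_le_of_isCouplingOf hS₀ h hπ]

/-! ### The upper bound from a linear transport map. -/

/-- The linear map given by `A` transports `N(0, S₀)` to `N(0, A S₀ Aᵀ)`. -/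
lemma wasserstein2_multivariateGaussian_le {p : ℕ} (A : Matrix (Fin p) (Fin p) ℝ)
    {S₀ : Matrix (Fin p) (Fin p) ℝ} (hS₀ : S₀.PosSemidef) :
    wasserstein2 (multivariateGaussian 0 (A * S₀ * Aᵀ)) (multivariateGaussian 0 S₀) ≤
      ENNReal.ofReal √((A - 1) * S₀ * (A - 1)ᵀ).trace := by
  have hm : Measurable fun y : EuclideanSpace ℝ (Fin p) ↦ (Matrix.toEuclideanCLM (𝕜 := ℝ) A y, y) :=
    by fun_prop
  have hπ : IsCouplingOf (multivariateGaussian 0 (A * S₀ * Aᵀ)) (multivariateGaussian 0 S₀)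
      ((multivariateGaussian 0 S₀).map fun y ↦ (Matrix.toEuclideanCLM (𝕜 := ℝ) A y, y)) := by
    constructor
    · rw [Measure.map_map measurable_fst hm, ← multivariateGaussian_map_toEuclideanCLM A hS₀]
      rfl
    · rw [Measure.map_map measurable_snd hm]
      exact Measure.map_id
  have hS₁ : ((A - 1) * S₀ * (A - 1)ᵀ).PosSemidef := by
    have := hS₀.mul_mul_conjTranspose_same (A - 1)
    rwa [Matrix.conjTranspose_eq_transpose_of_trivial] at this
  refine (iInf₂_le _ hπ).trans_eq ?_
  -- Under the law of (Ay, y) the difference is (A - 1)y, so the cost is the second moment of a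
  -- Gaussian.
  rw [lintegral_map (by fun_prop) hm, Real.sqrt_eq_rpow, ← ENNReal.ofReal_rpow_of_nonneg
    hS₁.trace_nonneg (by norm_num), ← integral_norm_sq_multivariateGaussian hS₁,
    ← lintegral_enorm_sq_eq_ofReal (f := fun ξ ↦ ξ) IsGaussian.memLp_two_id,
    ← multivariateGaussian_map_toEuclideanCLM (A - 1) hS₀, lintegral_map (by fun_prop) (by fun_prop)]
  simp

/-! ### The scalar equation for the multiplier. -/

/-- For `d, r > 0`, the equation `∑ i, r i * (d i / (γ - d i)) ^ 2 = c` with `c > 0` has exactly one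
solution above all the `d i`. -/
lemma existsUnique_sum_mul_div_sub_sq_eq {ι : Type*} [Fintype ι] [Nonempty ι] {d r : ι → ℝ}
    (hd : ∀ i, 0 < d i) (hr : ∀ i, 0 < r i) {c : ℝ} (hc : 0 < c) :
    ∃! γ : ℝ, (∀ i, d i < γ) ∧ ∑ i, r i * (d i / (γ - d i)) ^ 2 = c := by
  set f : ℝ → ℝ := fun γ ↦ ∑ i, r i * (d i / (γ - d i)) ^ 2 with hf
  have anti {a b : ℝ} (ha : ∀ i, d i < a) (hab : a < b) : f b < f a := by
    refine Finset.sum_lt_sum_of_nonempty Finset.univ_nonempty fun i _ ↦ ?_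
    have := ha i
    have := hd i
    have := hr i
    have : 0 < b - d i := by linarith
    gcongr
  obtain ⟨k, hk⟩ := Finite.exists_max d
  have hcont (a : ℝ) (ha : d k < a) (b : ℝ) : ContinuousOn f (Set.Icc a b) := by
    refine continuousOn_finsetSum _ fun i _ ↦ ?_
    refine continuousOn_const.mul (ContinuousOn.pow (continuousOn_const.div (by fun_prop) ?_) 2)
    intro x hx
    linarith [hx.1, hk i]
  have near : ∃ a, d k < a ∧ c ≤ f a := by
    -- At this point the k-th summand alone equals c.
    refine ⟨d k + d k * √(r k / c), ?_, ?_⟩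
    · have := hd k
      have := hr k
      have : 0 < d k * √(r k / c) := by positivity
      linarith
    · refine le_trans (le_of_eq ?_) (Finset.single_le_sum (f := fun i ↦ r i * (d i / (_ - d i)) ^ 2)
        (fun i _ ↦ mul_nonneg (hr i).le (sq_nonneg _)) (Finset.mem_univ k))
      have h1 := hd k
      have h2 := hr k
      rw [add_sub_cancel_left, div_mul_cancel_left₀ h1.ne', inv_pow, Real.sq_sqrt (by positivity)]
      field_simp
  have far : Filter.Tendsto f Filter.atTop (nhds 0) := by
    rw [show (0 : ℝ) = ∑ i, r i * 0 ^ 2 by simp]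
    refine tendsto_finsetSum _ fun i _ ↦ ((Filter.Tendsto.const_div_atTop ?_ _).pow 2).const_mul _
    exact Filter.tendsto_atTop_add_const_right _ _ Filter.tendsto_id
  obtain ⟨a, ha, hca⟩ := near
  obtain ⟨b, hb, hab⟩ := ((far.eventually_le_const hc).and (Filter.eventually_ge_atTop a)).exists
  obtain ⟨γ, hγ, hγc⟩ := intermediate_value_Icc' hab (hcont a ha b) ⟨hb, hca⟩
  refine ⟨γ, ⟨fun i ↦ by linarith [hk i, hγ.1], hγc⟩, ?_⟩
  rintro γ' ⟨h1, h2⟩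
  rcases lt_trichotomy γ' γ with h | h | h
  · exact absurd (anti h1 h) (by rw [show f γ' = c from h2, hγc]; exact lt_irrefl _)
  · exact h
  · exact absurd (anti (fun i ↦ by linarith [hk i, hγ.1]) h)
      (by rw [show f γ' = c from h2, hγc]; exact lt_irrefl _)

/-- The dual optimality conditions in an eigenbasis of `X`. -/
lemma exists_isDualSolution_iff {p : ℕ} (ρ : ℝ) {S₀ X : Matrix (Fin p) (Fin p) ℝ}
    (hS₀ : S₀.PosDef) (hX : X.PosDef) :
    ∃ d r : Fin p → ℝ, (∀ i, 0 < d i) ∧ (∀ i, 0 < r i) ∧ ∀ γ : ℝ, IsDualSolution ρ S₀ X γ ↔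
      (∀ i, d i < γ) ∧ ∑ i, r i * (d i / (γ - d i)) ^ 2 = ρ ^ 2 := by
  set d := hX.isHermitian.eigenvalues
  obtain ⟨U, hU⟩ : ∃ U : Matrix (Fin p) (Fin p) ℝ, U = hX.isHermitian.eigenvectorUnitary := ⟨_, rfl⟩
  have hUU : Uᵀ * U = 1 := by
    have := Unitary.coe_star_mul_self hX.isHermitian.eigenvectorUnitary
    rwa [← hU, Matrix.star_eq_conjTranspose, Matrix.conjTranspose_eq_transpose_of_trivial] at this
  have hUU' : U * Uᵀ = 1 := mul_eq_one_comm.mp hUU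
  have hXd : X = U * Matrix.diagonal d * Uᵀ := by
    have := hX.isHermitian.spectral_theorem
    rw [Unitary.conjStarAlgAut_apply, ← hU, Matrix.star_eq_conjTranspose,
      Matrix.conjTranspose_eq_transpose_of_trivial] at this
    exact this
  have hUinj : Function.Injective U.mulVec := by
    refine Function.LeftInverse.injective (g := Uᵀ.mulVec) fun x ↦ ?_
    rw [Matrix.mulVec_mulVec, hUU, Matrix.one_mulVec]
  have hR : (Uᵀ * S₀ * U).PosDef := by
    simpa using hS₀.conjTranspose_mul_mul_same hUinj
  -- The weights are the diagonal entries of S₀ in the eigenbasis.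
  refine ⟨d, fun i ↦ (Uᵀ * S₀ * U) i i, hX.eigenvalues_pos, fun i ↦ hR.diag_pos, fun γ ↦ ?_⟩
  have hM : γ • 1 - X = U * Matrix.diagonal (fun i ↦ γ - d i) * Uᵀ := by
    have : Matrix.diagonal (fun i ↦ γ - d i) = γ • 1 - Matrix.diagonal d := by
      rw [Matrix.smul_one_eq_diagonal, Matrix.diagonal_sub]
    rw [this, mul_sub, sub_mul, ← hXd, mul_smul_comm, mul_one, smul_mul_assoc, hUU']
  have hpos : (γ • (1 : Matrix (Fin p) (Fin p) ℝ) - X).PosDef ↔ ∀ i, d i < γ := by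
    have hUt : IsUnit U := IsUnit.of_mul_eq_one Uᵀ hUU'
    have := Matrix.IsUnit.posDef_star_right_conjugate_iff (x := Matrix.diagonal fun i ↦ γ - d i) hUt
    rw [Matrix.star_eq_conjTranspose, Matrix.conjTranspose_eq_transpose_of_trivial] at this
    rw [hM, this, Matrix.posDef_diagonal_iff]
    simp
  rw [IsDualSolution, hpos]
  refine and_congr_right fun hγ ↦ ?_
  have hne (i : Fin p) : γ - d i ≠ 0 := (sub_pos.2 (hγ i)).ne'
  have hinv : (γ • 1 - X)⁻¹ = U * Matrix.diagonal (fun i ↦ (γ - d i)⁻¹) * Uᵀ := by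
    refine Matrix.inv_eq_right_inv ?_
    calc _ = U * Matrix.diagonal (fun i ↦ γ - d i) * (Uᵀ * U)
          * Matrix.diagonal (fun i ↦ (γ - d i)⁻¹) * Uᵀ := by rw [hM]; simp only [mul_assoc]
      _ = _ := by
        rw [hUU, mul_one, mul_assoc U, Matrix.diagonal_mul_diagonal]
        simp [hne, hUU']
  have tr (v : Fin p → ℝ) : (U * Matrix.diagonal v * Uᵀ * S₀).trace =
      ∑ i, (Uᵀ * S₀ * U) i i * v i := by
    rw [mul_assoc, Matrix.trace_mul_comm, ← mul_assoc]
    simp only [Matrix.trace, Matrix.diag, Matrix.mul_diagonal]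
  have t₀ : S₀.trace = ∑ i, (Uᵀ * S₀ * U) i i := by
    rw [show S₀.trace = (U * Matrix.diagonal (fun _ ↦ (1 : ℝ)) * Uᵀ * S₀).trace by
      simp [hUU'], tr]
    simp
  have t₂ : ((γ • 1 - X)⁻¹ * S₀ * (γ • 1 - X)⁻¹).trace =
      ∑ i, (Uᵀ * S₀ * U) i i * ((γ - d i)⁻¹) ^ 2 := by
    rw [Matrix.trace_mul_comm, ← mul_assoc, ← tr, hinv]
    congr 2
    calc _ = U * Matrix.diagonal (fun i ↦ (γ - d i)⁻¹) * (Uᵀ * U)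
          * Matrix.diagonal (fun i ↦ (γ - d i)⁻¹) * Uᵀ := by simp only [mul_assoc]
      _ = _ := by
        rw [hUU, mul_one, mul_assoc U, Matrix.diagonal_mul_diagonal]
        simp only [sq]
  rw [t₂, hinv, tr, t₀]
  -- Termwise this is d/(γ - d) = γ/(γ - d) - 1, squared.
  have hs : ∑ i, (Uᵀ * S₀ * U) i i * (d i / (γ - d i)) ^ 2 = ∑ i, (Uᵀ * S₀ * U) i i
      - 2 * γ * ∑ i, (Uᵀ * S₀ * U) i i * (γ - d i)⁻¹
      + γ ^ 2 * ∑ i, (Uᵀ * S₀ * U) i i * ((γ - d i)⁻¹) ^ 2 := by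
    rw [Finset.mul_sum, Finset.mul_sum, ← Finset.sum_sub_distrib, ← Finset.sum_add_distrib]
    refine Finset.sum_congr rfl fun i _ ↦ ?_
    have := hne i
    field_simp
    ring
  rw [hs]
  constructor <;> intro h <;> linarith

/-! ### Tightness of the duality bound. -/

theorem theorem5p1 (p : ℕ) (hp : 0 < p) (ρ : ℝ) (hρ : 0 < ρ)
    (S₀ X : Matrix (Fin p) (Fin p) ℝ) (hS₀ : S₀.PosDef) (hX : X.PosDef) :
    (∃! γ : ℝ, IsDualSolution ρ S₀ X γ) ∧
    (∀ Q ∈ ambiguitySet ρ S₀, Integrable (quadLoss X) Q) ∧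
    ∀ γ : ℝ, IsDualSolution ρ S₀ X γ →
      (extremalCov S₀ X γ).PosSemidef ∧
      multivariateGaussian 0 (extremalCov S₀ X γ) ∈ ambiguitySet ρ S₀ ∧
      ((∫ ξ, quadLoss X ξ ∂(multivariateGaussian 0 (extremalCov S₀ X γ)) : ℝ) : EReal)
        = worstCaseExpectation ρ S₀ X ∧
      wasserstein2 (multivariateGaussian 0 (extremalCov S₀ X γ)) (multivariateGaussian 0 S₀)
        = ENNReal.ofReal ρ := by
  have : Nonempty (Fin p) := ⟨⟨0, hp⟩⟩
  obtain ⟨d, r, hd, hr, hiff⟩ := exists_isDualSolution_iff ρ hS₀ hX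
  refine ⟨?_, ?_, fun γ hγ ↦ ?_⟩
  · simp_rw [hiff]
    exact existsUnique_sum_mul_div_sub_sq_eq hd hr (by positivity)
  · rintro _ ⟨⟨S, -, rfl⟩, -⟩
    exact integrable_quadLoss X _
  have hγ0 : 0 < γ := (hd ⟨0, hp⟩).trans (((hiff γ).1 hγ).1 _)
  obtain ⟨hM, heq⟩ := hγ
  set N := (γ • (1 : Matrix (Fin p) (Fin p) ℝ) - X)⁻¹ with hN
  have hNt : Nᵀ = N := by simpa using hM.inv.isHermitian.eq
  have hXN : X * N = γ • N - 1 := by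
    have : (γ • 1 - X) * N = 1 := Matrix.mul_nonsing_inv _ hM.det_pos.ne'.isUnit
    rw [sub_mul, smul_mul_assoc, one_mul] at this
    rw [← this, sub_sub_cancel]
  have hcov : extremalCov S₀ X γ = (γ • N) * S₀ * (γ • N)ᵀ := by
    rw [extremalCov, Matrix.transpose_smul, hNt, mul_smul_comm, smul_mul_assoc, smul_mul_assoc,
      smul_smul, sq]
  have hpsd : (extremalCov S₀ X γ).PosSemidef := by
    simpa [hcov] using hS₀.posSemidef.mul_mul_conjTranspose_same (γ • N)
  -- Expanding the square turns the first-order equation into this cost identity.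
  have hcost : ((γ • N - 1) * S₀ * (γ • N - 1)ᵀ).trace = ρ ^ 2 := by
    have : (S₀ * N).trace = (N * S₀).trace := Matrix.trace_mul_comm _ _
    simp only [Matrix.transpose_sub, Matrix.transpose_smul, hNt, Matrix.transpose_one, mul_sub,
      sub_mul, mul_one, one_mul, smul_mul_assoc, mul_smul_comm, Matrix.trace_sub, Matrix.trace_smul,
      smul_eq_mul, this]
    linarith
  have hle : wasserstein2 (multivariateGaussian 0 (extremalCov S₀ X γ)) (multivariateGaussian 0 S₀)
      ≤ ENNReal.ofReal ρ := by
    have := wasserstein2_multivariateGaussian_le (γ • N) hS₀.posSemidef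
    rwa [hcost, Real.sqrt_sq hρ.le, ← hcov] at this
  -- The value equals the dual bound at cost ρ²: duality holds with equality.
  have hval : ∫ ξ, quadLoss X ξ ∂(multivariateGaussian 0 (extremalCov S₀ X γ)) =
      γ * ρ ^ 2 + (γ ^ 2 * (N * S₀).trace - γ * S₀.trace) := by
    have h1 : X * extremalCov S₀ X γ = γ ^ 2 • (γ • (N * S₀ * N) - S₀ * N) := by
      rw [extremalCov, ← hN, mul_smul_comm, ← mul_assoc, ← mul_assoc, hXN]
      simp only [sub_mul, smul_mul_assoc, one_mul]
    rw [integral_quadLoss_multivariateGaussian X hpsd, h1, Matrix.trace_smul, Matrix.trace_sub,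
      Matrix.trace_smul, Matrix.trace_mul_comm S₀ N, smul_eq_mul, smul_eq_mul]
    linear_combination -γ * heq
  have hmem : multivariateGaussian 0 (extremalCov S₀ X γ) ∈ ambiguitySet ρ S₀ :=
    ⟨⟨_, hpsd, rfl⟩, hle⟩
  refine ⟨hpsd, hmem, le_antisymm (le_iSup₂_of_le _ hmem le_rfl) (iSup₂_le ?_), le_antisymm hle ?_⟩
  · rintro _ ⟨⟨S, -, rfl⟩, hW⟩
    -- The lower bound on the distance, combined with distance at most ρ, becomes an upper bound on
    -- the loss.
    have := (ofReal_sqrt_le_wasserstein2 hγ0 hS₀.posSemidef hM (multivariateGaussian 0 S)).trans hW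
    rw [ENNReal.ofReal_le_ofReal_iff hρ.le, Real.sqrt_le_left hρ.le, div_le_iff₀ hγ0] at this
    rw [EReal.coe_le_coe_iff, hval]
    linarith
  · refine le_trans (le_of_eq ?_) (ofReal_sqrt_le_wasserstein2 hγ0 hS₀.posSemidef hM _)
    rw [hval, add_sub_cancel_right, mul_div_cancel_left₀ _ hγ0.ne', Real.sqrt_sq hρ.le]
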